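/- **Conventions.** A *$3$-precategory* is a $3$-globular set with identities and compositions $u \ast_i v$, for $u$ a $k$-cell and $v$ an $l$-cell with $i=\min(k,l)-1$, which are unital, associative and such that the composition $\ast_i$ with an $(i+1)$-cell distributes over $\ast_j$ for $j>i$ (no interchange law is required). A *$4$-prepolygraph* $\mathsf Q$ consists of sets $\mathsf Q_0,\dots,\mathsf Q_4$ of generators, where each $(i+1)$-generator has a source and a target which are parallel $i$-cells of the free precategory generated by the generators of dimension $\le i$. We write $\mathsf Q^*$ for the free $3$-precategory on the generators of dimension $\le 3$. Every $(i+1)$-cell of $\mathsf Q^*$ is, in a unique way, a composite for $\ast_i$ of whiskers; a whisker is an expression $l\ast_0\alpha\ast_0 r$ in dimension $2$ and $\lambda\ast_1(l\ast_0 A\ast_0 r)\ast_1\rho$ in dimension $3$, where $\alpha\in\mathsf Q_2$, $A\in\mathsf Q_3$, $l,r$ are $1$-cells and $\lambda,\rho$ are $2$-cells. The number of whiskers is the *length* of the cell. A *rewriting step* is a whisker of dimension $3$; a *rewriting path* is a $3$-cell of $\mathsf Q^*$. **Gray presentations.** A *Gray presentation* is a $4$-prepolygraph $\mathsf Q$ equipped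 with the following distinguished generators. 1. *Interchange generators*: for $\alpha\colon f\Rightarrow f'$ and $\beta\colon h\Rightarrow h'$ in $\mathsf Q_2$ and a $1$-cell $g$ such that $\alpha,g,\beta$ are $0$-composable, a $3$-generator $$X_{\alpha,g,\beta}\colon(\alpha\ast_0 g\ast_0 h)\ast_1(f'\ast_0 g\ast_0\beta)\Rrightarrow(f\ast_0 g\ast_0\beta)\ast_1(\alpha\ast_0 g\ast_0 h').$$ 2. *Independence generators*: for $A\colon\phi\Rrightarrow\phi'$ and $B\colon\psi\Rrightarrow\psi'$ in $\mathsf Q_3$, with $\phi,\phi'\colon f\Rightarrow g$ and $\psi,\psi'\colon f'\Rightarrow g'$, $1$-cells $e,h,e',h'$ and a $2$-cell $\chi\colon e\ast_0 g\ast_0 h\Rightarrow e'\ast_0 f'\ast_0 h'$, a $4$-generator from $$((e\ast_0 A\ast_0 h)\ast_1\chi\ast_1(e'\ast_0\psi\ast_0 h'))\ast_2((e\ast_0\phi'\ast_0 h)\ast_1\chi\ast_1(e'\ast_0 B\ast_0 h'))$$ to $$((e\ast_0\phi\ast_0 h)\ast_1\chi\ast_1(e'\ast_0 B\ast_0 h'))\ast_2((e\ast_0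 A\ast_0 h)\ast_1\chi\ast_1(e'\ast_0\psi'\ast_0 h')).$$ 3. *Interchange naturality generators*: for $0$-composable $A,g,\beta$, with $A\colon\phi\Rrightarrow\phi'$ in $\mathsf Q_3$ where $\phi,\phi'\colon f\Rightarrow f'$, $g$ a $1$-cell and $\beta\colon h\Rightarrow h'$ in $\mathsf Q_2$, a $4$-generator from $$((A\ast_0 g\ast_0 h)\ast_1(f'\ast_0 g\ast_0\beta))\ast_2 X_{\phi',g\ast_0\beta}\quad\text{to}\quad X_{\phi,g\ast_0\beta}\ast_2((f\ast_0 g\ast_0\beta)\ast_1(A\ast_0 g\ast_0 h'));$$ and, for $0$-composable $\alpha,g,B$, with $\alpha\colon f\Rightarrow f'$ in $\mathsf Q_2$, $g$ a $1$-cell and $B\colon\psi\Rrightarrow\psi'$ in $\mathsf Q_3$ where $\psi,\psi'\colon h\Rightarrow h'$, a $4$-generator from $$((\alpha\ast_0 g\ast_0 h)\ast_1(f'\ast_0 g\ast_0 B))\ast_2 X_{\alpha\ast_0 g,\psi'}\quad\text{to}\quad X_{\alpha\ast_0 g,\psi}\ast_2((f\ast_0 g\ast_0 B)\ast_1(\alpha\ast_0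 g\ast_0 h')).$$ Here, for $0$-composable $2$-cells $\phi=\phi_1\ast_1\cdots\ast_1\phi_k\colon f\Rightarrow f'$ and $\psi=\psi_1\ast_1\cdots\ast_1\psi_{k'}\colon g\Rightarrow g'$ decomposed into whiskers, the $3$-cell $$X_{\phi,\psi}\colon(\phi\ast_0 g)\ast_1(f'\ast_0\psi)\Rrightarrow(f\ast_0\psi)\ast_1(\phi\ast_0 g')$$ is the composite of $kk'$ rewriting steps which successively exchange $\phi_i$ with $\psi_j$, for $i=k,k-1,\dots,1$ and, for each $i$, $j=1,\dots,k'$. The step that exchanges $\phi_i=f_i\ast_0\alpha_i\ast_0 g_i\colon p\Rightarrow p'$ with $\psi_j=f'_j\ast_0\beta_j\ast_0 g'_j\colon q\Rightarrow q'$ is $\lambda\ast_1(f_i\ast_0 X_{\alpha_i,g_i\ast_0 f'_j,\beta_j}\ast_0 g'_j)\ast_1\rho$, where $$\lambda=((\phi_1\ast_1\cdots\ast_1\phi_{i-1})\ast_0 g)\ast_1(p\ast_0(\psi_1\ast_1\cdots\ast_1\psi_{j-1})),$$ $$\rho=(p'\ast_0(\psi_{j+1}\ast_1\cdots\ast_1\psi_{k'}))\ast_1((\phi_{i+1}\ast_1\cdots\ast_1\phi_k)\ast_0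 g').$$ **Presented category and coherence.** Let $\equiv$ be the smallest congruence on the $3$-cells of $\mathsf Q^*$ (an equivalence relation between parallel $3$-cells, stable under all compositions) that identifies the source and the target of each $4$-generator. The $3$-precategory *presented* by $\mathsf Q$ is $\overline{\mathsf Q}=\mathsf Q^*/{\equiv}$. Let $\overline{\mathsf Q}^{\top}$ be its localization, i.e. the $3$-precategory obtained by freely adding inverses for $\ast_2$ to all its $3$-cells. $\mathsf Q$ is *coherent* when any two parallel $3$-cells $F_1,F_2\colon\phi\Rrightarrow\psi$ of $\overline{\mathsf Q}^{\top}$ are equal. **Rewriting.** $\mathsf Q$ is *terminating* when there is no infinite sequence of rewriting steps $S_i\colon\phi_i\Rrightarrow\phi_{i+1}$, $i\ge 0$. A *local branching* is a pair $(S_1,S_2)$ of rewriting steps $S_1\colon\phi\Rrightarrow\phi_1$ and $S_2\colon\phi\Rrightarrow\phi_2$ with the same source; its symmetric branching is $(S_2,S_1)$. It is *confluent* when there are a $2$-cell $\psi$ and rewriting paths $G_1\colon\phi_1\Rrightarrow\psi$ and $G_2\colon\phi_2\Rrightarrow\psi$ with $S_1\ast_2 G_1\equiv S_2\ast_2 G_2$.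 It is - *trivial* when $S_1=S_2$; - *minimal* when, for every local branching $(S'_1,S'_2)$, $1$-cells $l,r$ and $2$-cells $\lambda,\rho$ such that $S_i=\lambda\ast_1(l\ast_0 S'_i\ast_0 r)\ast_1\rho$ for $i=1,2$, all of $l,r,\lambda,\rho$ are identities; - *independent* when $S_1=(l_1\ast_0 A_1\ast_0 r_1)\ast_1\chi\ast_1(l_2\ast_0\phi_2\ast_0 r_2)$ and $S_2=(l_1\ast_0\phi_1\ast_0 r_1)\ast_1\chi\ast_1(l_2\ast_0 A_2\ast_0 r_2)$ for some $1$-cells $l_i,r_i$, some $2$-cell $\chi$ and some $3$-generators $A_i\colon\phi_i\Rrightarrow\phi'_i$; - *natural* when either $S_1=(A\ast_0 g\ast_0 h)\ast_1(f'\ast_0 g\ast_0\psi)$ for some $3$-generator $A\colon\phi\Rrightarrow\phi'$ with $\phi,\phi'\colon f\Rightarrow f'$, $1$-cell $g$ and $2$-cell $\psi\colon h\Rightarrow h'$, with $\phi$ and $\psi$ of positive length, and $S_2$ is the first step of $X_{\phi,g\ast_0\psi}$; or $S_1=(\phi\ast_0 g\ast_0 h)\ast_1(f'\ast_0 g\ast_0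 B)$ for some $2$-cell $\phi\colon f\Rightarrow f'$, $1$-cell $g$ and $3$-generator $B\colon\psi\Rrightarrow\psi'$ with $\psi,\psi'\colon h\Rightarrow h'$, with $\phi$ and $\psi$ of positive length, and $S_2$ is the first step of $X_{\phi\ast_0 g,\psi}$; - *critical* when it is minimal, and neither it nor its symmetric branching is trivial, independent or natural. **Theorem (Coherence).** Let $\mathsf Q$ be a Gray presentation. If $\mathsf Q$ is terminating and every critical branching of $\mathsf Q$ is confluent, then $\mathsf Q$ is coherent. -/

import Mathlib

open CategoryTheory

universe u v w t s

set_option linter.checkUnivs false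

/-! ## Formal composites

A cell of dimension `n + 1` of the free precategory on a prepolygraph is, in a unique way, a
composite of composable whiskers (whiskered generators). The cells below are these composites. -/

/-- The list `L` of arrows (with sources `src` and targets `tgt`) is composable, from `a` to `b`. -/
def IsComposable {V : Type u} {σ : Type v} (src tgt : σ → V) : V → List σ → V → Prop
  | a, [], b => a = b
  | a, S :: L, b => src S = a ∧ IsComposable src tgt (tgt S) L b

/-- Formal composites from `a` to `b`; the empty one is the identity. -/
@[ext]
structure Composite {V : Type u} {σ : Type v} (src tgt : σ → V) (a b : V) where
  steps : List σ
  composable : IsComposable src tgt a steps b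

namespace IsComposable

variable {V : Type u} {σ : Type v} {src tgt : σ → V}

theorem append {a b c : V} {L M : List σ} (hL : IsComposable src tgt a L b)
    (hM : IsComposable src tgt b M c) : IsComposable src tgt a (L ++ M) c := by
  induction L generalizing a with
  | nil => cases hL; exact hM
  | cons S L ih => exact ⟨hL.1, ih hL.2⟩

theorem map {V' : Type*} {σ' : Type*} {src' tgt' : σ' → V'} (F : V → V') (G : σ → σ')
    (hs : ∀ S, src' (G S) = F (src S)) (ht : ∀ S, tgt' (G S) = F (tgt S))
    {a b : V} {L : List σ} (hL : IsComposable src tgt a L b) :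
    IsComposable src' tgt' (F a) (L.map G) (F b) := by
  induction L generalizing a with
  | nil => exact congrArg F hL
  | cons S L ih => exact ⟨by rw [hs, hL.1], by rw [ht]; exact ih hL.2⟩

end IsComposable

namespace Composite

variable {V : Type u} {σ : Type v} {src tgt : σ → V}

/-- The identity. -/
def id (a : V) : Composite src tgt a a := ⟨[], rfl⟩

/-- A single arrow, as a composite. -/
def single (S : σ) : Composite src tgt (src S) (tgt S) := ⟨[S], rfl, rfl⟩

/-- Composition. -/
def comp {a b c : V} (F : Composite src tgt a b) (G : Composite src tgt b c) :
    Composite src tgt a c :=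
  ⟨F.steps ++ G.steps, F.composable.append G.composable⟩

/-- The same composite, with source and target replaced by equal ones. -/
def copy {a b a' b' : V} (F : Composite src tgt a b) (ha : a = a') (hb : b = b') :
    Composite src tgt a' b' :=
  ⟨F.steps, ha ▸ hb ▸ F.composable⟩

/-- The image of a composite under a map of arrows that is compatible with sources and targets. -/
def map {V' : Type*} {σ' : Type*} {src' tgt' : σ' → V'} (F : V → V') (G : σ → σ')
    (hs : ∀ S, src' (G S) = F (src S)) (ht : ∀ S, tgt' (G S) = F (tgt S))
    {a b : V} (K : Composite src tgt a b) : Composite src' tgt' (F a) (F b) :=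
  ⟨K.steps.map G, K.composable.map F G hs ht⟩

@[simp] theorem steps_id (a : V) : (id a : Composite src tgt a a).steps = [] := rfl

@[simp] theorem steps_single (S : σ) :
    (single S : Composite src tgt (src S) (tgt S)).steps = [S] := rfl

@[simp] theorem steps_comp {a b c : V} (F : Composite src tgt a b) (G : Composite src tgt b c) :
    (F.comp G).steps = F.steps ++ G.steps := rfl

@[simp] theorem steps_copy {a b a' b' : V} (F : Composite src tgt a b) (ha : a = a')
    (hb : b = b') : (F.copy ha hb).steps = F.steps := rfl

@[simp] theorem steps_map {V' : Type*} {σ' : Type*} {src' tgt' : σ' → V'} (F : V → V')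
    (G : σ → σ') (hs : ∀ S, src' (G S) = F (src S)) (ht : ∀ S, tgt' (G S) = F (tgt S))
    {a b : V} (K : Composite src tgt a b) : (K.map F G hs ht).steps = K.steps.map G := rfl

end Composite

/-! ## Prepolygraphs of dimension 1 and 2, their 1-cells and 2-cells -/

/-- A 1-prepolygraph: 0-generators, and 1-generators between them. -/
structure Prepolygraph1 where
  Gen0 : Type u
  Gen1 : Gen0 → Gen0 → Type v

instance (P : Prepolygraph1.{u, v}) : Quiver.{v} P.Gen0 := ⟨P.Gen1⟩

/-- The 1-cells of the free precategory: composable sequences of 1-generators. -/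
abbrev Prepolygraph1.Cell1 (P : Prepolygraph1.{u, v}) (x y : P.Gen0) := Quiver.Path x y

/-- A 2-prepolygraph: moreover, 2-generators between parallel 1-cells. -/
structure Prepolygraph2 extends Prepolygraph1.{u, v} where
  Gen2 : ∀ {x y : Gen0}, toPrepolygraph1.Cell1 x y → toPrepolygraph1.Cell1 x y → Type w

namespace Prepolygraph2

/-- The 2-dimensional whisker `left ∘₀ gen ∘₀ right`, on a 2-generator `gen : dom ⇒ cod`. -/
structure Whisker2 (P : Prepolygraph2.{u, v, w}) (x y : P.Gen0) where
  {a b : P.Gen0}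
  {dom cod : P.Cell1 a b}
  left : P.Cell1 x a
  gen : P.Gen2 dom cod
  right : P.Cell1 b y

variable {P : Prepolygraph2.{u, v, w}}

namespace Whisker2

variable {x y z : P.Gen0}

def src (α : P.Whisker2 x y) : P.Cell1 x y := (α.left.comp α.dom).comp α.right

def tgt (α : P.Whisker2 x y) : P.Cell1 x y := (α.left.comp α.cod).comp α.right

/-- The generator `gen` with identity whiskers. -/
def ofGen {f g : P.Cell1 x y} (α : P.Gen2 f g) : P.Whisker2 x y :=
  { left := .nil, gen := α, right := .nil }

/-- `l ∘₀ α`. -/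
def whiskL (l : P.Cell1 x y) (α : P.Whisker2 y z) : P.Whisker2 x z :=
  { left := l.comp α.left, gen := α.gen, right := α.right }

/-- `α ∘₀ r`. -/
def whiskR (α : P.Whisker2 x y) (r : P.Cell1 y z) : P.Whisker2 x z :=
  { left := α.left, gen := α.gen, right := α.right.comp r }

theorem src_whiskL (l : P.Cell1 x y) (α : P.Whisker2 y z) :
    (whiskL l α).src = l.comp α.src := by
  simp [whiskL, src]

theorem tgt_whiskL (l : P.Cell1 x y) (α : P.Whisker2 y z) :
    (whiskL l α).tgt = l.comp α.tgt := by
  simp [whiskL, tgt]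

theorem src_whiskR (α : P.Whisker2 x y) (r : P.Cell1 y z) :
    (whiskR α r).src = α.src.comp r := by
  simp [whiskR, src]

theorem tgt_whiskR (α : P.Whisker2 x y) (r : P.Cell1 y z) :
    (whiskR α r).tgt = α.tgt.comp r := by
  simp [whiskR, tgt]

theorem whiskL_nil (α : P.Whisker2 x y) : whiskL .nil α = α := by
  simp [whiskL]

theorem whiskR_nil (α : P.Whisker2 x y) : whiskR α .nil = α := rfl

theorem whiskL_whiskL {x' : P.Gen0} (l : P.Cell1 x' x) (m : P.Cell1 x y) (α : P.Whisker2 y z) :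
    whiskL l (whiskL m α) = whiskL (l.comp m) α := by
  simp [whiskL]

theorem whiskR_whiskR {z' : P.Gen0} (α : P.Whisker2 x y) (m : P.Cell1 y z) (r : P.Cell1 z z') :
    whiskR (whiskR α m) r = whiskR α (m.comp r) := by
  simp [whiskR]

theorem whiskR_whiskL {x' : P.Gen0} (l : P.Cell1 x' x) (α : P.Whisker2 x y) (r : P.Cell1 y z) :
    whiskR (whiskL l α) r = whiskL l (whiskR α r) := rfl

end Whisker2

/-- The 2-cells `f ⇒ g` of the free precategory: composites, for `∘₁`, of 2-dimensional whiskers.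
The composition `∘₁` is `Composite.comp`, and the length of a 2-cell is the length of `steps`. -/
abbrev Cell2 (P : Prepolygraph2.{u, v, w}) {x y : P.Gen0} (f g : P.Cell1 x y) :=
  Composite (Whisker2.src (P := P) (x := x) (y := y)) Whisker2.tgt f g

namespace Cell2

variable {x y z : P.Gen0}

/-- A 2-generator, as a 2-cell. -/
def ofGen {f g : P.Cell1 x y} (α : P.Gen2 f g) : P.Cell2 f g :=
  (Composite.single (Whisker2.ofGen α)).copy
    (by simp [Whisker2.ofGen, Whisker2.src]) (by simp [Whisker2.ofGen, Whisker2.tgt])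

/-- `l ∘₀ φ`. -/
def whiskL (l : P.Cell1 x y) {f g : P.Cell1 y z} (φ : P.Cell2 f g) :
    P.Cell2 (l.comp f) (l.comp g) :=
  φ.map l.comp (Whisker2.whiskL l) (Whisker2.src_whiskL l) (Whisker2.tgt_whiskL l)

/-- `φ ∘₀ r`. -/
def whiskR {f g : P.Cell1 x y} (φ : P.Cell2 f g) (r : P.Cell1 y z) :
    P.Cell2 (f.comp r) (g.comp r) :=
  φ.map (fun f => f.comp r) (fun α => Whisker2.whiskR α r) (fun α => Whisker2.src_whiskR α r)
    (fun α => Whisker2.tgt_whiskR α r)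

@[simp] theorem steps_ofGen {f g : P.Cell1 x y} (α : P.Gen2 f g) :
    (ofGen α).steps = [Whisker2.ofGen α] := rfl

@[simp] theorem steps_whiskL (l : P.Cell1 x y) {f g : P.Cell1 y z} (φ : P.Cell2 f g) :
    (whiskL l φ).steps = φ.steps.map (Whisker2.whiskL l) := rfl

@[simp] theorem steps_whiskR {f g : P.Cell1 x y} (φ : P.Cell2 f g) (r : P.Cell1 y z) :
    (whiskR φ r).steps = φ.steps.map (fun α => Whisker2.whiskR α r) := rfl

/-- For `φ : f ⇒ f'` and `ψ : g ⇒ g'`, the 2-cell `(φ ∘₀ g) ∘₁ (f' ∘₀ ψ)`. -/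
def leftRight {f f' : P.Cell1 x y} {g g' : P.Cell1 y z} (φ : P.Cell2 f f') (ψ : P.Cell2 g g') :
    P.Cell2 (f.comp g) (f'.comp g') :=
  (whiskR φ g).comp (whiskL f' ψ)

/-- For `φ : f ⇒ f'` and `ψ : g ⇒ g'`, the 2-cell `(f ∘₀ ψ) ∘₁ (φ ∘₀ g')`. -/
def rightLeft {f f' : P.Cell1 x y} {g g' : P.Cell1 y z} (φ : P.Cell2 f f') (ψ : P.Cell2 g g') :
    P.Cell2 (f.comp g) (f'.comp g') :=
  (whiskL f ψ).comp (whiskR φ g')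

end Cell2

end Prepolygraph2

open Prepolygraph2 (Whisker2 Cell2)

/-! ## Prepolygraphs of dimension 3 and their 3-cells -/

/-- A 3-prepolygraph: moreover, 3-generators between parallel 2-cells. -/
structure Prepolygraph3 extends Prepolygraph2.{u, v, w} where
  Gen3 : ∀ {x y : Gen0} {f g : toPrepolygraph1.Cell1 x y},
    toPrepolygraph2.Cell2 f g → toPrepolygraph2.Cell2 f g → Type t

namespace Prepolygraph3

/-- The 3-dimensional whisker `top ∘₁ (left ∘₀ gen ∘₀ right) ∘₁ bot` on a 3-generator
`gen : dom ⇛ cod`, between 2-cells of type `f ⇒ g`; in other words, a rewriting step. -/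
@[ext]
structure Whisker3 (P : Prepolygraph3.{u, v, w, t}) {x y : P.Gen0} (f g : P.Cell1 x y) where
  {a b : P.Gen0}
  {p q : P.Cell1 a b}
  {dom cod : P.Cell2 p q}
  left : P.Cell1 x a
  gen : P.Gen3 dom cod
  right : P.Cell1 b y
  top : P.Cell2 f ((left.comp p).comp right)
  bot : P.Cell2 ((left.comp q).comp right) g

variable {P : Prepolygraph3.{u, v, w, t}}

namespace Whisker3

variable {x y z : P.Gen0}

def src {f g : P.Cell1 x y} (S : P.Whisker3 f g) : P.Cell2 f g :=
  (S.top.comp ((S.dom.whiskL S.left).whiskR S.right)).comp S.bot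

def tgt {f g : P.Cell1 x y} (S : P.Whisker3 f g) : P.Cell2 f g :=
  (S.top.comp ((S.cod.whiskL S.left).whiskR S.right)).comp S.bot

/-- The generator `A` with identity whiskers. -/
def ofGen {f g : P.Cell1 x y} {φ ψ : P.Cell2 f g} (A : P.Gen3 φ ψ) : P.Whisker3 f g :=
  { left := .nil
    gen := A
    right := .nil
    top := (Composite.id f).copy rfl (by simp)
    bot := (Composite.id g).copy (by simp) rfl }

/-- `l ∘₀ S`. -/
def whiskL (l : P.Cell1 x y) {f g : P.Cell1 y z} (S : P.Whisker3 f g) :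
    P.Whisker3 (l.comp f) (l.comp g) :=
  { left := l.comp S.left
    gen := S.gen
    right := S.right
    top := (S.top.whiskL l).copy rfl (by simp)
    bot := (S.bot.whiskL l).copy (by simp) rfl }

/-- `S ∘₀ r`. -/
def whiskR {f g : P.Cell1 x y} (S : P.Whisker3 f g) (r : P.Cell1 y z) :
    P.Whisker3 (f.comp r) (g.comp r) :=
  { left := S.left
    gen := S.gen
    right := S.right.comp r
    top := (S.top.whiskR r).copy rfl (by simp)
    bot := (S.bot.whiskR r).copy (by simp) rfl }

/-- `μ ∘₁ S`. -/
def precomp {f g h : P.Cell1 x y} (μ : P.Cell2 f g) (S : P.Whisker3 g h) : P.Whisker3 f h :=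
  { left := S.left
    gen := S.gen
    right := S.right
    top := μ.comp S.top
    bot := S.bot }

/-- `S ∘₁ ρ`. -/
def postcomp {f g h : P.Cell1 x y} (S : P.Whisker3 f g) (ρ : P.Cell2 g h) : P.Whisker3 f h :=
  { left := S.left
    gen := S.gen
    right := S.right
    top := S.top
    bot := S.bot.comp ρ }

theorem steps_src {f g : P.Cell1 x y} (S : P.Whisker3 f g) :
    S.src.steps = S.top.steps ++
      S.dom.steps.map (fun α => (α.whiskL S.left).whiskR S.right) ++ S.bot.steps := by
  simp [src, Function.comp_def]

theorem steps_tgt {f g : P.Cell1 x y} (S : P.Whisker3 f g) :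
    S.tgt.steps = S.top.steps ++
      S.cod.steps.map (fun α => (α.whiskL S.left).whiskR S.right) ++ S.bot.steps := by
  simp [tgt, Function.comp_def]

theorem src_ofGen {f g : P.Cell1 x y} {φ ψ : P.Cell2 f g} (A : P.Gen3 φ ψ) :
    (ofGen A).src = φ := by
  apply Composite.ext
  rw [steps_src]
  change [] ++ φ.steps.map (fun α => (α.whiskL .nil).whiskR .nil) ++ [] = φ.steps
  simp [Whisker2.whiskL_nil, Whisker2.whiskR_nil]

theorem tgt_ofGen {f g : P.Cell1 x y} {φ ψ : P.Cell2 f g} (A : P.Gen3 φ ψ) :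
    (ofGen A).tgt = ψ := by
  apply Composite.ext
  rw [steps_tgt]
  change [] ++ ψ.steps.map (fun α => (α.whiskL .nil).whiskR .nil) ++ [] = ψ.steps
  simp [Whisker2.whiskL_nil, Whisker2.whiskR_nil]

theorem src_whiskL (l : P.Cell1 x y) {f g : P.Cell1 y z} (S : P.Whisker3 f g) :
    (whiskL l S).src = S.src.whiskL l := by
  apply Composite.ext
  simp [src, whiskL, Function.comp_def, Whisker2.whiskL_whiskL, Whisker2.whiskR_whiskL]

theorem tgt_whiskL (l : P.Cell1 x y) {f g : P.Cell1 y z} (S : P.Whisker3 f g) :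
    (whiskL l S).tgt = S.tgt.whiskL l := by
  apply Composite.ext
  simp [tgt, whiskL, Function.comp_def, Whisker2.whiskL_whiskL, Whisker2.whiskR_whiskL]

theorem src_whiskR {f g : P.Cell1 x y} (r : P.Cell1 y z) (S : P.Whisker3 f g) :
    (whiskR S r).src = S.src.whiskR r := by
  apply Composite.ext
  simp [src, whiskR, Function.comp_def, Whisker2.whiskR_whiskR]

theorem tgt_whiskR {f g : P.Cell1 x y} (r : P.Cell1 y z) (S : P.Whisker3 f g) :
    (whiskR S r).tgt = S.tgt.whiskR r := by
  apply Composite.ext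
  simp [tgt, whiskR, Function.comp_def, Whisker2.whiskR_whiskR]

theorem src_precomp {f g h : P.Cell1 x y} (μ : P.Cell2 f g) (S : P.Whisker3 g h) :
    (precomp μ S).src = μ.comp S.src := by
  apply Composite.ext
  simp [src, precomp]

theorem tgt_precomp {f g h : P.Cell1 x y} (μ : P.Cell2 f g) (S : P.Whisker3 g h) :
    (precomp μ S).tgt = μ.comp S.tgt := by
  apply Composite.ext
  simp [tgt, precomp]

theorem src_postcomp {f g h : P.Cell1 x y} (ρ : P.Cell2 g h) (S : P.Whisker3 f g) :
    (postcomp S ρ).src = S.src.comp ρ := by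
  apply Composite.ext
  simp [src, postcomp]

theorem tgt_postcomp {f g h : P.Cell1 x y} (ρ : P.Cell2 g h) (S : P.Whisker3 f g) :
    (postcomp S ρ).tgt = S.tgt.comp ρ := by
  apply Composite.ext
  simp [tgt, postcomp]

end Whisker3

/-- The 3-cells `φ ⇛ ψ` of the free precategory: composites, for `∘₂`, of 3-dimensional whiskers;
in other words, rewriting paths. The composition `∘₂` is `Composite.comp`. -/
abbrev Cell3 (P : Prepolygraph3.{u, v, w, t}) {x y : P.Gen0} {f g : P.Cell1 x y}
    (φ ψ : P.Cell2 f g) :=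
  Composite (Whisker3.src (P := P) (f := f) (g := g)) Whisker3.tgt φ ψ

namespace Cell3

variable {x y z : P.Gen0}

/-- A 3-generator, as a 3-cell. -/
def ofGen {f g : P.Cell1 x y} {φ ψ : P.Cell2 f g} (A : P.Gen3 φ ψ) : P.Cell3 φ ψ :=
  (Composite.single (Whisker3.ofGen A)).copy (Whisker3.src_ofGen A) (Whisker3.tgt_ofGen A)

/-- `l ∘₀ F`, for a 1-cell `l`. -/
def whiskL (l : P.Cell1 x y) {f g : P.Cell1 y z} {φ ψ : P.Cell2 f g} (F : P.Cell3 φ ψ) :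
    P.Cell3 (φ.whiskL l) (ψ.whiskL l) :=
  F.map (Cell2.whiskL l) (Whisker3.whiskL l) (Whisker3.src_whiskL l) (Whisker3.tgt_whiskL l)

/-- `F ∘₀ r`, for a 1-cell `r`. -/
def whiskR {f g : P.Cell1 x y} {φ ψ : P.Cell2 f g} (F : P.Cell3 φ ψ) (r : P.Cell1 y z) :
    P.Cell3 (φ.whiskR r) (ψ.whiskR r) :=
  F.map (fun φ => φ.whiskR r) (fun S => S.whiskR r) (Whisker3.src_whiskR r)
    (Whisker3.tgt_whiskR r)

/-- `μ ∘₁ F`, for a 2-cell `μ`. -/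
def precomp {f g h : P.Cell1 x y} (μ : P.Cell2 f g) {φ ψ : P.Cell2 g h} (F : P.Cell3 φ ψ) :
    P.Cell3 (μ.comp φ) (μ.comp ψ) :=
  F.map μ.comp (Whisker3.precomp μ) (Whisker3.src_precomp μ) (Whisker3.tgt_precomp μ)

/-- `F ∘₁ ρ`, for a 2-cell `ρ`. -/
def postcomp {f g h : P.Cell1 x y} {φ ψ : P.Cell2 f g} (F : P.Cell3 φ ψ) (ρ : P.Cell2 g h) :
    P.Cell3 (φ.comp ρ) (ψ.comp ρ) :=
  F.map (fun φ => φ.comp ρ) (fun S => S.postcomp ρ) (Whisker3.src_postcomp ρ)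
    (Whisker3.tgt_postcomp ρ)

end Cell3

/-- The category of 2-cells `f ⇒ g` and 3-cells between them, with composition `∘₂`. -/
def HomCat (P : Prepolygraph3.{u, v, w, t}) {x y : P.Gen0} (f g : P.Cell1 x y) := P.Cell2 f g

instance {x y : P.Gen0} (f g : P.Cell1 x y) : Category (P.HomCat f g) where
  Hom φ ψ := P.Cell3 (f := f) (g := g) φ ψ
  id φ := Composite.id φ
  comp F G := Composite.comp F G
  id_comp _ := Composite.ext (List.nil_append _)
  comp_id _ := Composite.ext (List.append_nil _)
  assoc _ _ _ := Composite.ext (List.append_assoc _ _ _)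

/-- No infinite sequence of composable rewriting steps. -/
def IsTerminating (P : Prepolygraph3.{u, v, w, t}) : Prop :=
  ¬ ∃ (x y : P.Gen0) (f g : P.Cell1 x y) (S : ℕ → P.Whisker3 f g),
    ∀ i, (S i).tgt = (S (i + 1)).src

/-! ### Interchangers -/

/-- A choice of 3-generators
`X_{α,m,β} : (α ∘₀ m ∘₀ h) ∘₁ (f' ∘₀ m ∘₀ β) ⇛ (f ∘₀ m ∘₀ β) ∘₁ (α ∘₀ m ∘₀ h')`
for `0`-composable `α : f ⇒ f'`, `m` and `β : h ⇒ h'`, with `α` and `β` generators. -/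
def InterchangeFamily (P : Prepolygraph3.{u, v, w, t}) :=
  ∀ ⦃a b c d : P.Gen0⦄ ⦃f f' : P.Cell1 a b⦄ ⦃h h' : P.Cell1 c d⦄
    (α : P.Gen2 f f') (m : P.Cell1 b c) (β : P.Gen2 h h'),
    P.Gen3 (Cell2.leftRight (Cell2.ofGen α) ((Cell2.ofGen β).whiskL m))
      (Cell2.rightLeft (Cell2.ofGen α) ((Cell2.ofGen β).whiskL m))

section Interchange

variable (I : P.InterchangeFamily) {x y z : P.Gen0}

/-- For `φ = φ₀ ∘₁ α ∘₁ φ₁ : f ⇒ f'` and `ψ = ψ₀ ∘₁ β ∘₁ ψ₁ : g ⇒ g'` with whiskers `α` and `β`,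
the rewriting step
`l₁ ⋯ lᵢ₋₁ r₁ ⋯ rⱼ₋₁ (lᵢ rⱼ) rⱼ₊₁ ⋯ lᵢ₊₁ ⋯ ⇛ l₁ ⋯ lᵢ₋₁ r₁ ⋯ rⱼ₋₁ (rⱼ lᵢ) rⱼ₊₁ ⋯ lᵢ₊₁ ⋯`
which exchanges `α` (the letter `lᵢ`) and `β` (the letter `rⱼ`) in a shuffle of the whiskers of
`φ` (the letters `l`) and of `ψ` (the letters `r`), by an interchange generator in context. -/
def swapStep {f f' : P.Cell1 x y} {g g' : P.Cell1 y z} (α : P.Whisker2 x y) (β : P.Whisker2 y z)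
    (φ₀ : P.Cell2 f α.src) (φ₁ : P.Cell2 α.tgt f') (ψ₀ : P.Cell2 g β.src)
    (ψ₁ : P.Cell2 β.tgt g') : P.Whisker3 (f.comp g) (f'.comp g') :=
  { left := α.left
    gen := I α.gen (α.right.comp β.left) β.gen
    right := β.right
    top := ((φ₀.whiskR g).comp (ψ₀.whiskL α.src)).copy rfl (by simp [Whisker2.src])
    bot := ((ψ₁.whiskL α.tgt).comp (φ₁.whiskR g')).copy (by simp [Whisker2.tgt]) rfl }

theorem steps_src_swapStep {f f' : P.Cell1 x y} {g g' : P.Cell1 y z} (α : P.Whisker2 x y)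
    (β : P.Whisker2 y z) (φ₀ : P.Cell2 f α.src) (φ₁ : P.Cell2 α.tgt f') (ψ₀ : P.Cell2 g β.src)
    (ψ₁ : P.Cell2 β.tgt g') :
    (swapStep I α β φ₀ φ₁ ψ₀ ψ₁).src.steps =
      (φ₀.whiskR g).steps ++ (ψ₀.whiskL α.src).steps ++ [α.whiskR β.src] ++ [β.whiskL α.tgt] ++
        (ψ₁.whiskL α.tgt).steps ++ (φ₁.whiskR g').steps := by
  have hmid : (Cell2.leftRight (Cell2.ofGen α.gen)
      ((Cell2.ofGen β.gen).whiskL (α.right.comp β.left))).steps.map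
        (fun γ => (γ.whiskL α.left).whiskR β.right) = [α.whiskR β.src, β.whiskL α.tgt] := by
    simp [Cell2.leftRight, Whisker2.src, Whisker2.tgt, Whisker2.whiskL, Whisker2.whiskR, Whisker2.ofGen]
  rw [Whisker3.steps_src]
  change ((φ₀.whiskR g).steps ++ (ψ₀.whiskL α.src).steps) ++ List.map _ _ ++
    ((ψ₁.whiskL α.tgt).steps ++ (φ₁.whiskR g').steps) = _
  refine (congrArg (fun L => ((φ₀.whiskR g).steps ++ (ψ₀.whiskL α.src).steps) ++ L ++
    ((ψ₁.whiskL α.tgt).steps ++ (φ₁.whiskR g').steps)) hmid).trans ?_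
  simp

theorem steps_tgt_swapStep {f f' : P.Cell1 x y} {g g' : P.Cell1 y z} (α : P.Whisker2 x y)
    (β : P.Whisker2 y z) (φ₀ : P.Cell2 f α.src) (φ₁ : P.Cell2 α.tgt f') (ψ₀ : P.Cell2 g β.src)
    (ψ₁ : P.Cell2 β.tgt g') :
    (swapStep I α β φ₀ φ₁ ψ₀ ψ₁).tgt.steps =
      (φ₀.whiskR g).steps ++ (ψ₀.whiskL α.src).steps ++ [β.whiskL α.src] ++ [α.whiskR β.tgt] ++
        (ψ₁.whiskL α.tgt).steps ++ (φ₁.whiskR g').steps := by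
  have hmid : (Cell2.rightLeft (Cell2.ofGen α.gen)
      ((Cell2.ofGen β.gen).whiskL (α.right.comp β.left))).steps.map
        (fun γ => (γ.whiskL α.left).whiskR β.right) = [β.whiskL α.src, α.whiskR β.tgt] := by
    simp [Cell2.rightLeft, Whisker2.src, Whisker2.tgt, Whisker2.whiskL, Whisker2.whiskR, Whisker2.ofGen]
  rw [Whisker3.steps_tgt]
  change ((φ₀.whiskR g).steps ++ (ψ₀.whiskL α.src).steps) ++ List.map _ _ ++
    ((ψ₁.whiskL α.tgt).steps ++ (φ₁.whiskR g').steps) = _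
  refine (congrArg (fun L => ((φ₀.whiskR g).steps ++ (ψ₀.whiskL α.src).steps) ++ L ++
    ((ψ₁.whiskL α.tgt).steps ++ (φ₁.whiskR g').steps)) hmid).trans ?_
  simp

/-- The exchanges of the whisker `α` of `φ = φ₀ ∘₁ α ∘₁ φ₁` with all the whiskers of a list `Ψ`,
from left to right, where `ψ = ψ₀ ∘₁ Ψ`. -/
def swapRow {f f' : P.Cell1 x y} {g g' : P.Cell1 y z} (α : P.Whisker2 x y)
    (φ₀ : P.Cell2 f α.src) (φ₁ : P.Cell2 α.tgt f') :
    ∀ (Ψ : List (P.Whisker2 y z)) {q : P.Cell1 y z} (_ : P.Cell2 g q)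
      (_ : IsComposable Whisker2.src Whisker2.tgt q Ψ g'),
      List (P.Whisker3 (f.comp g) (f'.comp g'))
  | [], _, _, _ => []
  | β :: Ψ, _, ψ₀, h =>
      swapStep I α β φ₀ φ₁ (ψ₀.copy rfl h.1.symm) ⟨Ψ, h.2⟩ ::
        swapRow α φ₀ φ₁ Ψ ((ψ₀.copy rfl h.1.symm).comp (Composite.single β)) h.2

theorem swapRow_composable {f f' : P.Cell1 x y} {g g' : P.Cell1 y z} (α : P.Whisker2 x y)
    (φ₀ : P.Cell2 f α.src) (φ₁ : P.Cell2 α.tgt f') (Ψ : List (P.Whisker2 y z))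
    {q : P.Cell1 y z} (ψ₀ : P.Cell2 g q) (h : IsComposable Whisker2.src Whisker2.tgt q Ψ g')
    (χ χ' : P.Cell2 (f.comp g) (f'.comp g'))
    (hχ : χ.steps = (φ₀.whiskR g).steps ++ (ψ₀.whiskL α.src).steps ++ [α.whiskR q] ++
      Ψ.map (Whisker2.whiskL α.tgt) ++ (φ₁.whiskR g').steps)
    (hχ' : χ'.steps = (φ₀.whiskR g).steps ++ (ψ₀.whiskL α.src).steps ++
      Ψ.map (Whisker2.whiskL α.src) ++ [α.whiskR g'] ++ (φ₁.whiskR g').steps) :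
    IsComposable Whisker3.src Whisker3.tgt χ (swapRow I α φ₀ φ₁ Ψ ψ₀ h) χ' := by
  induction Ψ generalizing q χ with
  | nil =>
    cases h
    apply Composite.ext
    rw [hχ, hχ']
    simp
  | cons β Ψ ih =>
    obtain ⟨rfl, h⟩ := h
    refine ⟨?_, ih _ h _ ?_ ?_⟩
    · apply Composite.ext
      rw [steps_src_swapStep, hχ]
      simp
    · rw [steps_tgt_swapStep]
      simp
    · rw [hχ']
      simp

/-- The exchanges of the whiskers of a list `Φ`, from right to left, with all the whiskers of `ψ`,
where `φ = φ₀ ∘₁ Φ`. -/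
def swapAll {f f' : P.Cell1 x y} {g g' : P.Cell1 y z} (ψ : P.Cell2 g g') :
    ∀ (Φ : List (P.Whisker2 x y)) {p : P.Cell1 x y} (_ : P.Cell2 f p)
      (_ : IsComposable Whisker2.src Whisker2.tgt p Φ f'),
      List (P.Whisker3 (f.comp g) (f'.comp g'))
  | [], _, _, _ => []
  | α :: Φ, _, φ₀, h =>
      swapAll ψ Φ ((φ₀.copy rfl h.1.symm).comp (Composite.single α)) h.2 ++
        swapRow I α (φ₀.copy rfl h.1.symm) ⟨Φ, h.2⟩ ψ.steps (Composite.id g) ψ.composable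

theorem swapAll_composable {f f' : P.Cell1 x y} {g g' : P.Cell1 y z} (ψ : P.Cell2 g g')
    (Φ : List (P.Whisker2 x y)) {p : P.Cell1 x y} (φ₀ : P.Cell2 f p)
    (h : IsComposable Whisker2.src Whisker2.tgt p Φ f')
    (χ χ' : P.Cell2 (f.comp g) (f'.comp g'))
    (hχ : χ.steps = (φ₀.whiskR g).steps ++ Φ.map (fun α => α.whiskR g) ++
      (ψ.whiskL f').steps)
    (hχ' : χ'.steps = (φ₀.whiskR g).steps ++ (ψ.whiskL p).steps ++
      Φ.map (fun α => α.whiskR g')) :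
    IsComposable Whisker3.src Whisker3.tgt χ (swapAll I ψ Φ φ₀ h) χ' := by
  induction Φ generalizing p χ' with
  | nil =>
    cases h
    apply Composite.ext
    rw [hχ, hχ']
    simp
  | cons α Φ ih =>
    obtain ⟨rfl, h⟩ := h
    let φ₁ : P.Cell2 α.tgt f' := ⟨Φ, h⟩
    refine (ih _ h ((φ₀.whiskR g).comp (((Cell2.whiskR (Composite.single α) g).comp
      (ψ.whiskL α.tgt)).comp (φ₁.whiskR g'))) ?_ ?_).append
      (swapRow_composable I α _ _ _ _ _ _ _ ?_ ?_)
    · rw [hχ]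
      simp
    · simp [φ₁]
    · simp [φ₁]
    · rw [hχ']
      simp

/-- The 3-cell `X_{φ,ψ} : (φ ∘₀ g) ∘₁ (f' ∘₀ ψ) ⇛ (f ∘₀ ψ) ∘₁ (φ ∘₀ g')`: the standard path
`l₁ ⋯ l_k r₁ ⋯ r_k' ⇛ r₁ ⋯ r_k' l₁ ⋯ l_k`, where the last whisker `l_k` of `φ` is first moved
below `r₁`, ..., `r_k'`, then `l_{k-1}` is, and so on. -/
def interchanger {f f' : P.Cell1 x y} {g g' : P.Cell1 y z} (φ : P.Cell2 f f')
    (ψ : P.Cell2 g g') : P.Cell3 (Cell2.leftRight φ ψ) (Cell2.rightLeft φ ψ) :=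
  ⟨swapAll I ψ φ.steps (Composite.id f) φ.composable,
    swapAll_composable I ψ _ _ _ _ _ (by simp [Cell2.leftRight]) (by simp [Cell2.rightLeft])⟩

/-- `S` is the step `l₁ ⋯ l_{k-1} (l_k r₁) r₂ ⋯ r_k' ⇛ l₁ ⋯ l_{k-1} (r₁ l_k) r₂ ⋯ r_k'` which
exchanges the last whisker `α = l_k` of `φ` and the first whisker `β = r₁` of `ψ`. -/
def IsFirstSwap {f f' : P.Cell1 x y} {g g' : P.Cell1 y z} (φ : P.Cell2 f f')
    (ψ : P.Cell2 g g') (S : P.Whisker3 (f.comp g) (f'.comp g')) : Prop :=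
  ∃ (α : P.Whisker2 x y) (β : P.Whisker2 y z) (φ₀ : P.Cell2 f α.src) (φ₁ : P.Cell2 α.tgt f')
    (ψ₀ : P.Cell2 g β.src) (ψ₁ : P.Cell2 β.tgt g'),
    φ.steps = φ₀.steps ++ [α] ∧ φ₁.steps = [] ∧ ψ₀.steps = [] ∧ ψ.steps = β :: ψ₁.steps ∧
      S = swapStep I α β φ₀ φ₁ ψ₀ ψ₁

end Interchange

/-! ### Local branchings -/

/-- A pair of rewriting steps with the same source. -/
structure LocalBranching (P : Prepolygraph3.{u, v, w, t}) {x y : P.Gen0} (f g : P.Cell1 x y) where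
  fst : P.Whisker3 f g
  snd : P.Whisker3 f g
  src_eq : fst.src = snd.src

namespace LocalBranching

variable {x y : P.Gen0} {f g : P.Cell1 x y}

/-- The branching in the other order. -/
def symm (b : P.LocalBranching f g) : P.LocalBranching f g := ⟨b.snd, b.fst, b.src_eq.symm⟩

def IsTrivial (b : P.LocalBranching f g) : Prop := b.fst = b.snd

/-- Whenever `b = μ ∘₁ (l ∘₀ b' ∘₀ r) ∘₁ ρ` for a local branching `b'`, all of `l`, `r`, `μ`, `ρ`
are identities. -/
def IsMinimal (b : P.LocalBranching f g) : Prop :=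
  ∀ (x' y' : P.Gen0) (f' g' : P.Cell1 x' y') (b' : P.LocalBranching f' g')
    (l : P.Cell1 x x') (r : P.Cell1 y' y) (μ : P.Cell2 f ((l.comp f').comp r))
    (ρ : P.Cell2 ((l.comp g').comp r) g),
    b.fst = (((b'.fst.whiskL l).whiskR r).precomp μ).postcomp ρ →
    b.snd = (((b'.snd.whiskL l).whiskR r).precomp μ).postcomp ρ →
    l.length = 0 ∧ r.length = 0 ∧ μ.steps = [] ∧ ρ.steps = []

end LocalBranching

/-- The pair `S₁ = (l₁ ∘₀ A₁ ∘₀ r₁) ∘₁ χ ∘₁ (l₂ ∘₀ φ₂ ∘₀ r₂)` and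
`S₂ = (l₁ ∘₀ φ₁ ∘₀ r₁) ∘₁ χ ∘₁ (l₂ ∘₀ A₂ ∘₀ r₂)`, where `Aᵢ : φᵢ ⇛ φᵢ'` are 3-generators. -/
inductive IsIndependent (P : Prepolygraph3.{u, v, w, t}) :
    ∀ {x y : P.Gen0} {f g : P.Cell1 x y}, P.Whisker3 f g → P.Whisker3 f g → Prop
  | mk {x y a₁ b₁ a₂ b₂ : P.Gen0} {f₁ g₁ : P.Cell1 a₁ b₁} {f₂ g₂ : P.Cell1 a₂ b₂}
      {φ₁ φ₁' : P.Cell2 f₁ g₁} {φ₂ φ₂' : P.Cell2 f₂ g₂} (A₁ : P.Gen3 φ₁ φ₁') (A₂ : P.Gen3 φ₂ φ₂')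
      (l₁ : P.Cell1 x a₁) (r₁ : P.Cell1 b₁ y) (l₂ : P.Cell1 x a₂) (r₂ : P.Cell1 b₂ y)
      (χ : P.Cell2 ((l₁.comp g₁).comp r₁) ((l₂.comp f₂).comp r₂)) :
      IsIndependent P
        ((((Whisker3.ofGen A₁).whiskL l₁).whiskR r₁).postcomp
          (χ.comp ((φ₂.whiskL l₂).whiskR r₂)))
        ((((Whisker3.ofGen A₂).whiskL l₂).whiskR r₂).precomp
          (((φ₁.whiskL l₁).whiskR r₁).comp χ))

/-- The pair `S₁ = (A ∘₀ g ∘₀ h) ∘₁ (f' ∘₀ g ∘₀ ψ)` and `S₂`, the first step of `X_{φ, g ∘₀ ψ}`,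
for a 3-generator `A : φ ⇛ φ'`; or the pair `S₁ = (φ ∘₀ g ∘₀ h) ∘₁ (f' ∘₀ g ∘₀ B)` and `S₂`, the
first step of `X_{φ ∘₀ g, ψ}`, for a 3-generator `B : ψ ⇛ ψ'`. -/
inductive IsNatural {P : Prepolygraph3.{u, v, w, t}} (I : P.InterchangeFamily) :
    ∀ {x y : P.Gen0} {f g : P.Cell1 x y}, P.Whisker3 f g → P.Whisker3 f g → Prop
  | left {a b c d : P.Gen0} {f f' : P.Cell1 a b} {φ φ' : P.Cell2 f f'} (A : P.Gen3 φ φ')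
      (g : P.Cell1 b c) {h h' : P.Cell1 c d} (ψ : P.Cell2 h h')
      (S₂ : P.Whisker3 (f.comp (g.comp h)) (f'.comp (g.comp h')))
      (hS₂ : IsFirstSwap I φ (ψ.whiskL g) S₂) :
      IsNatural I
        (((Whisker3.ofGen A).whiskR (g.comp h)).postcomp ((ψ.whiskL g).whiskL f')) S₂
  | right {a b c d : P.Gen0} {f f' : P.Cell1 a b} (φ : P.Cell2 f f') (g : P.Cell1 b c)
      {h h' : P.Cell1 c d} {ψ ψ' : P.Cell2 h h'} (B : P.Gen3 ψ ψ')
      (S₂ : P.Whisker3 ((f.comp g).comp h) ((f'.comp g).comp h'))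
      (hS₂ : IsFirstSwap I (φ.whiskR g) ψ S₂) :
      IsNatural I
        (((Whisker3.ofGen B).whiskL (f'.comp g)).precomp ((φ.whiskR g).whiskR h)) S₂

/-- A critical branching: minimal, and neither it nor its symmetric branching is trivial,
independent or natural. -/
def LocalBranching.IsCritical {P : Prepolygraph3.{u, v, w, t}} (I : P.InterchangeFamily)
    {x y : P.Gen0} {f g : P.Cell1 x y} (b : P.LocalBranching f g) : Prop :=
  b.IsMinimal ∧
    (¬ b.IsTrivial ∧ ¬ P.IsIndependent b.fst b.snd ∧ ¬ IsNatural I b.fst b.snd) ∧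
    (¬ b.symm.IsTrivial ∧ ¬ P.IsIndependent b.symm.fst b.symm.snd ∧
      ¬ IsNatural I b.symm.fst b.symm.snd)

end Prepolygraph3

open Prepolygraph3 (Whisker3 Cell3)

/-! ## Prepolygraphs of dimension 4 and Gray presentations -/

/-- A 4-prepolygraph: moreover, 4-generators between parallel 3-cells. -/
structure Prepolygraph4 extends Prepolygraph3.{u, v, w, t} where
  Gen4 : ∀ {x y : Gen0} {f g : toPrepolygraph1.Cell1 x y} {φ ψ : toPrepolygraph2.Cell2 f g},
    toPrepolygraph3.Cell3 φ ψ → toPrepolygraph3.Cell3 φ ψ → Type s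

namespace Prepolygraph4

/-- The smallest congruence on the free 3-precategory which identifies the source and the target
of each 4-generator. -/
inductive Congr (Q : Prepolygraph4.{u, v, w, t, s}) :
    ∀ {x y : Q.Gen0} {f g : Q.Cell1 x y} {φ ψ : Q.Cell2 f g}, Q.Cell3 φ ψ → Q.Cell3 φ ψ → Prop
  | gen {x y : Q.Gen0} {f g : Q.Cell1 x y} {φ ψ : Q.Cell2 f g} {F G : Q.Cell3 φ ψ}
      (R : Q.Gen4 F G) : Congr Q F G
  | refl {x y : Q.Gen0} {f g : Q.Cell1 x y} {φ ψ : Q.Cell2 f g} (F : Q.Cell3 φ ψ) : Congr Q F F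
  | symm {x y : Q.Gen0} {f g : Q.Cell1 x y} {φ ψ : Q.Cell2 f g} {F G : Q.Cell3 φ ψ}
      (h : Congr Q F G) : Congr Q G F
  | trans {x y : Q.Gen0} {f g : Q.Cell1 x y} {φ ψ : Q.Cell2 f g} {F G H : Q.Cell3 φ ψ}
      (h : Congr Q F G) (h' : Congr Q G H) : Congr Q F H
  | comp {x y : Q.Gen0} {f g : Q.Cell1 x y} {φ ψ χ : Q.Cell2 f g} {F F' : Q.Cell3 φ ψ}
      {G G' : Q.Cell3 ψ χ} (h : Congr Q F F') (h' : Congr Q G G') :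
      Congr Q (F.comp G) (F'.comp G')
  | precomp {x y : Q.Gen0} {f g h : Q.Cell1 x y} (μ : Q.Cell2 f g) {φ ψ : Q.Cell2 g h}
      {F G : Q.Cell3 φ ψ} (hFG : Congr Q F G) : Congr Q (F.precomp μ) (G.precomp μ)
  | postcomp {x y : Q.Gen0} {f g h : Q.Cell1 x y} (ρ : Q.Cell2 g h) {φ ψ : Q.Cell2 f g}
      {F G : Q.Cell3 φ ψ} (hFG : Congr Q F G) : Congr Q (F.postcomp ρ) (G.postcomp ρ)
  | whiskL {x y z : Q.Gen0} (l : Q.Cell1 x y) {f g : Q.Cell1 y z} {φ ψ : Q.Cell2 f g}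
      {F G : Q.Cell3 φ ψ} (hFG : Congr Q F G) : Congr Q (F.whiskL l) (G.whiskL l)
  | whiskR {x y z : Q.Gen0} (r : Q.Cell1 y z) {f g : Q.Cell1 x y} {φ ψ : Q.Cell2 f g}
      {F G : Q.Cell3 φ ψ} (hFG : Congr Q F G) : Congr Q (F.whiskR r) (G.whiskR r)

variable (Q : Prepolygraph4.{u, v, w, t, s})

/-- The branching `(F₁, F₂)` is confluent for the congruence of `Q`. -/
def IsConfluent {x y : Q.Gen0} {f g : Q.Cell1 x y} {φ φ₁ φ₂ : Q.Cell2 f g}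
    (F₁ : Q.Cell3 φ φ₁) (F₂ : Q.Cell3 φ φ₂) : Prop :=
  ∃ (ψ : Q.Cell2 f g) (G₁ : Q.Cell3 φ₁ ψ) (G₂ : Q.Cell3 φ₂ ψ),
    Q.Congr (F₁.comp G₁) (F₂.comp G₂)

/-- A local branching is confluent for the congruence of `Q`. -/
def IsConfluentLocal {x y : Q.Gen0} {f g : Q.Cell1 x y} (b : Q.LocalBranching f g) : Prop :=
  Q.IsConfluent (Composite.single b.fst : Q.Cell3 b.fst.src b.fst.tgt)
    ((Composite.single b.snd : Q.Cell3 b.snd.src b.snd.tgt).copy b.src_eq.symm rfl)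

/-- The congruence of `Q`, on the 3-cells between 2-cells of type `f ⇒ g`. -/
def homRel {x y : Q.Gen0} (f g : Q.Cell1 x y) : HomRel (Q.HomCat f g) :=
  fun φ ψ F G => Q.Congr (φ := φ) (ψ := ψ) F G

/-- The 2-cells `f ⇒ g`, and the 3-cells of the presented precategory between them, with `∘₂`:
3-cells of the free precategory up to the congruence of `Q`. -/
abbrev PresentedHomCat {x y : Q.Gen0} (f g : Q.Cell1 x y) :=
  CategoryTheory.Quotient (Q.homRel f g)

/-- The 3-cells `φ ⇛ ψ` of the localization of the presented precategory: classes of zigzags of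
3-cells of the presented precategory, i.e. morphisms of the free groupoid on the category of
2-cells `f ⇒ g` and 3-cells between them. -/
def LocalizedCell3 {x y : Q.Gen0} {f g : Q.Cell1 x y} (φ ψ : Q.Cell2 f g) :=
  FreeGroupoid.mk (C := Q.PresentedHomCat f g) ⟨φ⟩ ⟶ FreeGroupoid.mk (C := Q.PresentedHomCat f g) ⟨ψ⟩

/-- Parallel 3-cells of the localization of the presented precategory are equal. -/
def IsCoherent : Prop :=
  ∀ (x y : Q.Gen0) (f g : Q.Cell1 x y) (φ ψ : Q.Cell2 f g) (F₁ F₂ : Q.LocalizedCell3 φ ψ),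
    F₁ = F₂

/-- Independence generators: for 3-generators `A : φ ⇛ φ' : f ⇒ g` and `B : ψ ⇛ ψ' : f' ⇒ g'`,
1-cells `e, h, e', h'`, and a 2-cell `χ : e ∘₀ g ∘₀ h ⇒ e' ∘₀ f' ∘₀ h'`, a 4-generator from
`((e ∘₀ A ∘₀ h) ∘₁ χ ∘₁ (e' ∘₀ ψ ∘₀ h')) ∘₂ ((e ∘₀ φ' ∘₀ h) ∘₁ χ ∘₁ (e' ∘₀ B ∘₀ h'))` to
`((e ∘₀ φ ∘₀ h) ∘₁ χ ∘₁ (e' ∘₀ B ∘₀ h')) ∘₂ ((e ∘₀ A ∘₀ h) ∘₁ χ ∘₁ (e' ∘₀ ψ' ∘₀ h'))`. -/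
def IndependenceFamily :=
  ∀ ⦃p z x y x' y' : Q.Gen0⦄ ⦃f g : Q.Cell1 x y⦄ ⦃f' g' : Q.Cell1 x' y'⦄
    ⦃φ φ' : Q.Cell2 f g⦄ ⦃ψ ψ' : Q.Cell2 f' g'⦄ (A : Q.Gen3 φ φ') (B : Q.Gen3 ψ ψ')
    (e : Q.Cell1 p x) (h : Q.Cell1 y z) (e' : Q.Cell1 p x') (h' : Q.Cell1 y' z)
    (χ : Q.Cell2 ((e.comp g).comp h) ((e'.comp f').comp h')),
    Q.Gen4
      (((((Cell3.ofGen A).whiskL e).whiskR h).postcomp (χ.comp ((ψ.whiskL e').whiskR h'))).comp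
        (((((Cell3.ofGen B).whiskL e').whiskR h').precomp χ).precomp ((φ'.whiskL e).whiskR h)))
      ((((((Cell3.ofGen B).whiskL e').whiskR h').precomp χ).precomp
          ((φ.whiskL e).whiskR h)).comp
        ((((Cell3.ofGen A).whiskL e).whiskR h).postcomp (χ.comp ((ψ'.whiskL e').whiskR h'))))

/-- Interchange naturality generators of the first kind: for a 3-generator
`A : φ ⇛ φ' : f ⇒ f'`, a 1-cell `g` and a 2-generator `β : h ⇒ h'`, a 4-generator from
`((A ∘₀ g ∘₀ h) ∘₁ (f' ∘₀ g ∘₀ β)) ∘₂ X_{φ',g ∘₀ β}` to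
`X_{φ,g ∘₀ β} ∘₂ ((f ∘₀ g ∘₀ β) ∘₁ (A ∘₀ g ∘₀ h'))`. -/
def NaturalityLeftFamily (X : Q.InterchangeFamily) :=
  ∀ ⦃x x' y' y : Q.Gen0⦄ ⦃f f' : Q.Cell1 x x'⦄ ⦃φ φ' : Q.Cell2 f f'⦄ (A : Q.Gen3 φ φ')
    (g : Q.Cell1 x' y') ⦃h h' : Q.Cell1 y' y⦄ (β : Q.Gen2 h h'),
    Q.Gen4
      ((((Cell3.ofGen A).whiskR (g.comp h)).postcomp (((Cell2.ofGen β).whiskL g).whiskL f')).comp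
        (Prepolygraph3.interchanger X φ' ((Cell2.ofGen β).whiskL g)))
      ((Prepolygraph3.interchanger X φ ((Cell2.ofGen β).whiskL g)).comp
        (((Cell3.ofGen A).whiskR (g.comp h')).precomp (((Cell2.ofGen β).whiskL g).whiskL f)))

/-- Interchange naturality generators of the second kind: for a 2-generator `α : f ⇒ f'`, a
1-cell `g` and a 3-generator `B : ψ ⇛ ψ' : h ⇒ h'`, a 4-generator from
`((α ∘₀ g ∘₀ h) ∘₁ (f' ∘₀ g ∘₀ B)) ∘₂ X_{α ∘₀ g,ψ'}` to
`X_{α ∘₀ g,ψ} ∘₂ ((f ∘₀ g ∘₀ B) ∘₁ (α ∘₀ g ∘₀ h'))`. -/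
def NaturalityRightFamily (X : Q.InterchangeFamily) :=
  ∀ ⦃x x' y' y : Q.Gen0⦄ ⦃f f' : Q.Cell1 x x'⦄ (α : Q.Gen2 f f') (g : Q.Cell1 x' y')
    ⦃h h' : Q.Cell1 y' y⦄ ⦃ψ ψ' : Q.Cell2 h h'⦄ (B : Q.Gen3 ψ ψ'),
    Q.Gen4
      ((((Cell3.ofGen B).whiskL (f'.comp g)).precomp (((Cell2.ofGen α).whiskR g).whiskR h)).comp
        (Prepolygraph3.interchanger X ((Cell2.ofGen α).whiskR g) ψ'))
      ((Prepolygraph3.interchanger X ((Cell2.ofGen α).whiskR g) ψ).comp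
        (((Cell3.ofGen B).whiskL (f.comp g)).postcomp (((Cell2.ofGen α).whiskR g).whiskR h')))

end Prepolygraph4

/-- A Gray presentation: a 4-prepolygraph with distinguished interchange generators, independence
generators, and interchange naturality generators. -/
structure GrayPresentation extends Prepolygraph4.{u, v, w, t, s} where
  X : toPrepolygraph3.InterchangeFamily
  independence : toPrepolygraph4.IndependenceFamily
  naturalityLeft : toPrepolygraph4.NaturalityLeftFamily X
  naturalityRight : toPrepolygraph4.NaturalityRightFamily X

/-!
The proof follows Squier's coherence theorem. `Closes S₁ S₂` says that the rewriting steps `S₁` and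
`S₂` start two parallel rewriting paths identified by the congruence.

Every local branching closes (`GrayPresentation.closes_of_critical`). Indeed closing is stable under
contexts (`Closes.context`), and removing a nontrivial context decreases the size of a branching
(`size_lt_of_context`), so that it is enough to treat minimal branchings. A minimal branching is
either critical, and closes by hypothesis, or trivial, independent or natural, up to symmetry. An
independent branching is closed by an independence generator. In a natural branching between a
3-generator and a cell `ψ`, the step `S₂` moves only the whisker of `ψ` next to the 3-generator;
the rest of `ψ` is a context around a branching closed by a naturality generator, because the
exchange `S₂` is the first step of the interchanger (`IsFirstSwap.head?_interchanger`). The natural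
branchings of the other kind are symmetric.

With termination, Newman's argument then shows that two rewriting paths from a 2-cell to normal
forms have the same target and are congruent (`congr_of_isNormal`). A choice of normalizations
`N φ : φ ⇛ nf φ` thus commutes with all 3-cells `F : φ ⇛ ψ`, in the sense that `nf φ = nf ψ` and
`N φ = F ∘₂ N ψ`. In the localization every 3-cell `φ ⇛ ψ` is therefore `N φ` followed by the
inverse of `N ψ`, whence coherence (`FreeGroupoid.hom_ext_of_normalization`).
-/

/-! ### Free groupoids on normalizing categories -/

namespace CategoryTheory.FreeGroupoid

/-- If every object `X` has a morphism `N X` to a chosen object, and these morphisms commute with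
all morphisms of `C` (so that the chosen objects of connected objects are equal), then parallel
morphisms of the free groupoid are equal: `N` is a natural isomorphism from the identity to a
functor that factors through a discrete category. -/
theorem hom_ext_of_normalization {C : Type*} [Category* C] (nf : C → C) (N : ∀ X, X ⟶ nf X)
    (hN : ∀ {X Y : C} (f : X ⟶ Y), ∃ e : nf X = nf Y, N X ≫ eqToHom e = f ≫ N Y)
    {X Y : FreeGroupoid C} (f g : X ⟶ Y) : f = g := by
  -- Connected objects have equal chosen objects, so that choosing is a functor to `Discrete C`.
  let D : C ⥤ Discrete C :=
    { obj X := ⟨nf X⟩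
      map f := Discrete.eqToHom (hN f).choose
      map_id _ := Subsingleton.elim _ _
      map_comp _ _ := Subsingleton.elim _ _ }
  let K : FreeGroupoid C ⥤ FreeGroupoid C := lift D ⋙ Discrete.functor (of C).obj
  let τ : 𝟭 (FreeGroupoid C) ≅ K :=
    liftNatIso _ _ (NatIso.ofComponents (fun X => asIso ((of C).map (N X))) (by
      intro X Y f
      obtain ⟨e, he⟩ := hN f
      have hD : (of C ⋙ K).map f = (of C).map (eqToHom e) := by
        rw [eqToHom_map]
        rfl
      rw [hD]
      exact (((of C).map_comp _ _).symm.trans (congrArg (of C).map he.symm)).trans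
        ((of C).map_comp _ _)))
  have hK : K.map f = K.map g :=
    congrArg (Discrete.functor (of C).obj).map
      (Subsingleton.elim ((lift D).map f) ((lift D).map g))
  have hf := τ.hom.naturality f
  rw [hK, ← τ.hom.naturality g] at hf
  exact (cancel_mono _).mp hf

end CategoryTheory.FreeGroupoid

/-! ### Steps of composites and of whiskers -/

theorem IsComposable.exists_of_append {V : Type u} {σ : Type v} {src tgt : σ → V} {a b : V}
    {L M : List σ} (h : IsComposable src tgt a (L ++ M) b) :
    ∃ c, IsComposable src tgt a L c ∧ IsComposable src tgt c M b := by
  induction L generalizing a with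
  | nil => exact ⟨a, rfl, h⟩
  | cons S L ih =>
    obtain ⟨c, hL, hM⟩ := ih h.2
    exact ⟨c, ⟨h.1, hL⟩, hM⟩

namespace Composite

variable {V : Type u} {σ : Type v} {src tgt : σ → V}

theorem eq_of_steps_eq_nil {a b : V} (F : Composite src tgt a b) (h : F.steps = []) : a = b := by
  have := F.composable
  rwa [h] at this

theorem head?_steps_comp {a b c : V} {F : Composite src tgt a b} {S : σ}
    (h : F.steps.head? = some S) (G : Composite src tgt b c) :
    (F.comp G).steps.head? = some S := by
  rw [steps_comp, List.head?_append, h]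
  rfl

end Composite

namespace Prepolygraph2.Whisker2

variable {P : Prepolygraph2.{u, v, w}} {x y z : P.Gen0}

theorem tgt_ofGen {f g : P.Cell1 x y} (α : P.Gen2 f g) : (ofGen α).tgt = g := by
  simp [ofGen, tgt]

theorem whiskL_whiskR_ofGen (α : P.Whisker2 x y) (r : P.Cell1 y z) :
    whiskL α.left (whiskR (ofGen α.gen) (α.right.comp r)) = α.whiskR r := by
  simp [whiskL, whiskR, ofGen]

end Prepolygraph2.Whisker2

namespace Prepolygraph3

variable {P : Prepolygraph3.{u, v, w, t}}

namespace Whisker3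

variable {x y z : P.Gen0}

@[simp] theorem steps_top_ofGen {f g : P.Cell1 x y} {φ ψ : P.Cell2 f g} (A : P.Gen3 φ ψ) :
    (ofGen A).top.steps = [] := rfl

@[simp] theorem steps_bot_ofGen {f g : P.Cell1 x y} {φ ψ : P.Cell2 f g} (A : P.Gen3 φ ψ) :
    (ofGen A).bot.steps = [] := rfl

@[simp] theorem steps_top_whiskL (l : P.Cell1 x y) {f g : P.Cell1 y z} (S : P.Whisker3 f g) :
    (whiskL l S).top.steps = S.top.steps.map (Whisker2.whiskL l) := rfl

@[simp] theorem steps_bot_whiskL (l : P.Cell1 x y) {f g : P.Cell1 y z} (S : P.Whisker3 f g) :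
    (whiskL l S).bot.steps = S.bot.steps.map (Whisker2.whiskL l) := rfl

@[simp] theorem steps_top_whiskR {f g : P.Cell1 x y} (S : P.Whisker3 f g) (r : P.Cell1 y z) :
    (whiskR S r).top.steps = S.top.steps.map (fun α => Whisker2.whiskR α r) := rfl

@[simp] theorem steps_bot_whiskR {f g : P.Cell1 x y} (S : P.Whisker3 f g) (r : P.Cell1 y z) :
    (whiskR S r).bot.steps = S.bot.steps.map (fun α => Whisker2.whiskR α r) := rfl

@[simp] theorem steps_top_precomp {f g h : P.Cell1 x y} (μ : P.Cell2 f g) (S : P.Whisker3 g h) :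
    (precomp μ S).top.steps = μ.steps ++ S.top.steps := rfl

@[simp] theorem steps_bot_precomp {f g h : P.Cell1 x y} (μ : P.Cell2 f g) (S : P.Whisker3 g h) :
    (precomp μ S).bot.steps = S.bot.steps := rfl

@[simp] theorem steps_top_postcomp {f g h : P.Cell1 x y} (S : P.Whisker3 f g) (ρ : P.Cell2 g h) :
    (postcomp S ρ).top.steps = S.top.steps := rfl

@[simp] theorem steps_bot_postcomp {f g h : P.Cell1 x y} (S : P.Whisker3 f g) (ρ : P.Cell2 g h) :
    (postcomp S ρ).bot.steps = S.bot.steps ++ ρ.steps := rfl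

/-- Whiskers on the same generator agree as soon as their 1-cells and the whiskers composing their
2-cells do. -/
theorem mk_congr {a b : P.Gen0} {f g : P.Cell1 x y} {p q : P.Cell1 a b} {dom cod : P.Cell2 p q}
    (A : P.Gen3 dom cod) {l l' : P.Cell1 x a} {r r' : P.Cell1 b y}
    {μ : P.Cell2 f ((l.comp p).comp r)} {μ' : P.Cell2 f ((l'.comp p).comp r')}
    {ρ : P.Cell2 ((l.comp q).comp r) g} {ρ' : P.Cell2 ((l'.comp q).comp r') g}
    (hl : l = l') (hr : r = r') (hμ : μ.steps = μ'.steps) (hρ : ρ.steps = ρ'.steps) :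
    (⟨l, A, r, μ, ρ⟩ : P.Whisker3 f g) = ⟨l', A, r', μ', ρ'⟩ := by
  subst hl hr
  rw [Composite.ext hμ, Composite.ext hρ]

/-- The variant of `mk_congr` for interchange generators: their types depend on the middle
1-cells `m` and `m'`, which need not be definitionally equal. -/
theorem mk_congr_interchange (I : P.InterchangeFamily) {a b c d : P.Gen0} {f g : P.Cell1 x y}
    {p p' : P.Cell1 a b} {q q' : P.Cell1 c d} (α : P.Gen2 p p') (β : P.Gen2 q q')
    {m m' : P.Cell1 b c} {l l' : P.Cell1 x a} {r r' : P.Cell1 d y}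
    {μ : P.Cell2 f ((l.comp (p.comp (m.comp q))).comp r)}
    {μ' : P.Cell2 f ((l'.comp (p.comp (m'.comp q))).comp r')}
    {ρ : P.Cell2 ((l.comp (p'.comp (m.comp q'))).comp r) g}
    {ρ' : P.Cell2 ((l'.comp (p'.comp (m'.comp q'))).comp r') g}
    (hm : m = m') (hl : l = l') (hr : r = r') (hμ : μ.steps = μ'.steps)
    (hρ : ρ.steps = ρ'.steps) :
    (⟨l, I α m β, r, μ, ρ⟩ : P.Whisker3 f g) = ⟨l', I α m' β, r', μ', ρ'⟩ := by
  subst hm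
  exact mk_congr _ hl hr hμ hρ

end Whisker3

/-! ### The first step of an interchanger -/

section Interchange

variable (I : P.InterchangeFamily) {x y z : P.Gen0}

/-- The exchanges start with that of the last whisker `α` and the first whisker of `ψ`, since the
whiskers are moved from right to left. -/
theorem swapAll_head? {f f' : P.Cell1 x y} {g g' : P.Cell1 y z} (ψ : P.Cell2 g g')
    (α : P.Whisker2 x y) (β : P.Whisker2 y z) (φ : P.Cell2 f α.src) (φ₁ : P.Cell2 α.tgt f')
    (ψ₀ : P.Cell2 g β.src) (ψ₁ : P.Cell2 β.tgt g') (hφ₁ : φ₁.steps = []) (hψ₀ : ψ₀.steps = [])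
    (hψ : ψ.steps = β :: ψ₁.steps) (Φ : List (P.Whisker2 x y)) {p : P.Cell1 x y}
    (φ₀ : P.Cell2 f p) (h : IsComposable Whisker2.src Whisker2.tgt p (Φ ++ [α]) f')
    (hφ : φ.steps = φ₀.steps ++ Φ) :
    (swapAll I ψ (Φ ++ [α]) φ₀ h).head? = some (swapStep I α β φ φ₁ ψ₀ ψ₁) := by
  induction Φ generalizing p with
  | nil =>
    obtain ⟨Ψ, hΨ⟩ := ψ
    obtain rfl : Ψ = _ := hψ
    simp only [List.nil_append, swapAll, swapRow, List.head?_cons]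
    congr 2
    · exact Composite.ext (by simpa using hφ.symm)
    · exact Composite.ext hφ₁.symm
    · exact Composite.ext (by simp [hψ₀])
  | cons γ Φ ih =>
    simp only [List.cons_append, swapAll, List.head?_append]
    rw [ih _ h.2 (by simp [hφ])]
    rfl

theorem IsFirstSwap.head?_interchanger {f f' : P.Cell1 x y} {g g' : P.Cell1 y z}
    {φ : P.Cell2 f f'} {ψ : P.Cell2 g g'} {S : P.Whisker3 (f.comp g) (f'.comp g')}
    (hS : IsFirstSwap I φ ψ S) : (interchanger I φ ψ).steps.head? = some S := by
  obtain ⟨α, β, φ₀, φ₁, ψ₀, ψ₁, hφ, hφ₁, hψ₀, hψ, rfl⟩ := hS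
  obtain ⟨Φ, hΦ⟩ := φ
  obtain rfl : Φ = _ := hφ
  exact swapAll_head? I ψ α β φ₀ φ₁ ψ₀ ψ₁ hφ₁ hψ₀ hψ _ _ _ rfl

end Interchange

end Prepolygraph3

/-! ### Branchings closed by the congruence -/

namespace Prepolygraph4

open Prepolygraph3

variable {Q : Prepolygraph4.{u, v, w, t, s}} {x y : Q.Gen0} {f g : Q.Cell1 x y}

/-- The rewriting steps `S₁` and `S₂` are the first steps of two parallel rewriting paths that are
identified by the congruence. For steps with the same source this is confluence, in a form that
does not mention the equality of the sources. -/
def Closes (S₁ S₂ : Q.Whisker3 f g) : Prop :=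
  ∃ (φ ψ : Q.Cell2 f g) (F₁ F₂ : Q.Cell3 φ ψ),
    F₁.steps.head? = some S₁ ∧ F₂.steps.head? = some S₂ ∧ Q.Congr F₁ F₂

theorem Closes.symm {S₁ S₂ : Q.Whisker3 f g} (h : Closes S₁ S₂) : Closes S₂ S₁ := by
  obtain ⟨φ, ψ, F₁, F₂, h₁, h₂, h⟩ := h
  exact ⟨φ, ψ, F₂, F₁, h₂, h₁, h.symm⟩

theorem Closes.refl (S : Q.Whisker3 f g) : Closes S S :=
  ⟨_, _, Composite.single S, Composite.single S, rfl, rfl, .refl _⟩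

theorem Closes.context {x' y' : Q.Gen0} {f' g' : Q.Cell1 x' y'} {S₁ S₂ : Q.Whisker3 f' g'}
    (h : Closes S₁ S₂) (l : Q.Cell1 x x') (r : Q.Cell1 y' y)
    (μ : Q.Cell2 f ((l.comp f').comp r)) (ρ : Q.Cell2 ((l.comp g').comp r) g) :
    Closes ((((S₁.whiskL l).whiskR r).precomp μ).postcomp ρ)
      ((((S₂.whiskL l).whiskR r).precomp μ).postcomp ρ) := by
  obtain ⟨φ, ψ, F₁, F₂, h₁, h₂, h⟩ := h
  refine ⟨_, _, (((F₁.whiskL l).whiskR r).precomp μ).postcomp ρ,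
    (((F₂.whiskL l).whiskR r).precomp μ).postcomp ρ, ?_, ?_,
    (((h.whiskL l).whiskR r).precomp μ).postcomp ρ⟩ <;>
  simp [Cell3.whiskL, Cell3.whiskR, Cell3.precomp, Cell3.postcomp, h₁, h₂]

theorem IsConfluentLocal.closes {b : Q.LocalBranching f g} (h : Q.IsConfluentLocal b) :
    Closes b.fst b.snd := by
  obtain ⟨ψ, G₁, G₂, h⟩ := h
  exact ⟨_, _, _, _, rfl, rfl, h⟩

/-- The size of a branching decreases strictly when a nontrivial context is removed: the source
becomes shorter if the context contains a 2-cell of positive length, and otherwise its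
1-dimensional source does. -/
theorem size_lt_of_context {x' y' : Q.Gen0} {f' g' : Q.Cell1 x' y'} (S : Q.Whisker3 f' g')
    (l : Q.Cell1 x x') (r : Q.Cell1 y' y) (μ : Q.Cell2 f ((l.comp f').comp r))
    (ρ : Q.Cell2 ((l.comp g').comp r) g)
    (h : ¬ (l.length = 0 ∧ r.length = 0 ∧ μ.steps = [] ∧ ρ.steps = [])) :
    Prod.Lex (· < ·) (· < ·) (S.src.steps.length, f'.length)
      (((((S.whiskL l).whiskR r).precomp μ).postcomp ρ).src.steps.length, f.length) := by
  have hlen : ((((S.whiskL l).whiskR r).precomp μ).postcomp ρ).src.steps.length =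
      μ.steps.length + S.src.steps.length + ρ.steps.length := by
    rw [Whisker3.src_postcomp, Whisker3.src_precomp, Whisker3.src_whiskR, Whisker3.src_whiskL]
    simp [add_assoc]
  rw [hlen, Prod.lex_def]
  by_cases hμ : μ.steps = []
  · by_cases hρ : ρ.steps = []
    · right
      have hf : f.length = l.length + f'.length + r.length := by
        rw [μ.eq_of_steps_eq_nil hμ]
        simp [add_assoc]
      refine ⟨by simp [hμ, hρ], ?_⟩
      have : ¬ (l.length = 0 ∧ r.length = 0) := fun h' => h ⟨h'.1, h'.2, hμ, hρ⟩
      dsimp only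
      omega
    · have := List.length_pos_iff.mpr hρ
      left
      dsimp only
      omega
  · have := List.length_pos_iff.mpr hμ
    left
    dsimp only
    omega

end Prepolygraph4

/-! ### Local branchings of Gray presentations -/

namespace GrayPresentation

open Prepolygraph3 Prepolygraph4

variable {Q : GrayPresentation.{u, v, w, t, s}}

theorem closes_of_isIndependent {x y : Q.Gen0} {f g : Q.Cell1 x y} {S₁ S₂ : Q.Whisker3 f g}
    (h : Q.IsIndependent S₁ S₂) : Closes S₁ S₂ := by
  obtain ⟨A₁, A₂, l₁, r₁, l₂, r₂, χ⟩ := h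
  refine ⟨_, _, _, _, ?_, ?_, .gen (Q.independence A₁ A₂ l₁ r₁ l₂ r₂ χ)⟩
  · rfl
  · exact congrArg some (Whisker3.mk_congr _ rfl rfl (by simp) rfl)

/-- Only the first whisker of `ψ` (resp. the last whisker of `φ`) matters in a natural branching:
the other ones, and the 1-cell on its outer side, form a context around the branching closed by a
naturality generator. -/
theorem closes_of_isNatural {x y : Q.Gen0} {f g : Q.Cell1 x y} {S₁ S₂ : Q.Whisker3 f g}
    (h : IsNatural Q.X S₁ S₂) : Closes S₁ S₂ := by
  cases h with
  | left A g ψ S₂ hS₂ =>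
    rename_i b c f f' φ φ' h h'
    obtain ⟨α, β, φ₀, φ₁, ψ₀, ψ₁, hφ, hφ₁, hψ₀, hψ, rfl⟩ := hS₂
    obtain ⟨Ψ, hΨ⟩ := ψ
    cases Ψ with
    | nil => simp at hψ
    | cons β Ψ =>
      obtain ⟨rfl, hΨ⟩ := hΨ
      simp only [Cell2.steps_whiskL, List.map_cons, List.cons.injEq] at hψ
      obtain ⟨rfl, hψ₁⟩ := hψ
      -- The branching on the first whisker of `ψ`, stripped of its right 1-cell `β.right`.
      have hbase : Closes
          (((Whisker3.ofGen A).whiskR ((g.comp β.left).comp β.dom)).postcomp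
            (((Cell2.ofGen β.gen).whiskL (g.comp β.left)).whiskL f'))
          (swapStep Q.X α ((Whisker2.ofGen β.gen).whiskL (g.comp β.left)) φ₀ φ₁
            ((Composite.id _).copy rfl (by simp [Whisker2.src, Whisker2.whiskL, Whisker2.ofGen]))
            ((Composite.id _).copy (by simp [Whisker2.tgt, Whisker2.whiskL, Whisker2.ofGen])
              rfl)) := by
        refine ⟨_, _, _, _, ?_, ?_, .gen (Q.naturalityLeft A (g.comp β.left) β.gen)⟩
        · rfl
        · exact Composite.head?_steps_comp (IsFirstSwap.head?_interchanger Q.X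
            ⟨_, _, _, _, _, _, hφ, hφ₁, rfl, rfl, rfl⟩) _
      -- The context: `β.right` on the right, and the remaining whiskers of `ψ` below.
      have := hbase.context (f := f.comp (g.comp β.src)) (g := f'.comp (g.comp h')) .nil β.right
        ((Composite.id _).copy rfl (by simp [Whisker2.src]))
        (((Cell2.whiskL g (⟨Ψ, hΨ⟩ : Q.Cell2 β.tgt h')).whiskL f').copy
          (by simp [Whisker2.tgt]) rfl)
      -- In the comparison with the context, the types of the composites agree only up to unfolding:
      -- `change` spells out the lists of whiskers.
      convert this using 1
      · refine Whisker3.mk_congr _ ?_ ?_ ?_ ?_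
        · rfl
        · change Quiver.Path.comp .nil (g.comp ((β.left.comp β.dom).comp β.right)) =
            (Quiver.Path.comp .nil ((g.comp β.left).comp β.dom)).comp β.right
          simp
        · simp
        · simp [Whisker2.whiskL, Whisker2.whiskR, Whisker2.ofGen]
      · refine Whisker3.mk_congr_interchange Q.X _ _ ?_ ?_ ?_ ?_ ?_
        · rfl
        · exact (Quiver.Path.nil_comp _).symm
        · exact (Quiver.Path.nil_comp _).symm
        · change φ₀.steps.map (Whisker2.whiskR · (g.comp β.src)) ++
              ψ₀.steps.map (Whisker2.whiskL α.src) =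
            ((φ₀.steps.map (Whisker2.whiskR · ((g.comp β.left).comp β.dom)) ++ []).map
              (Whisker2.whiskL .nil)).map (Whisker2.whiskR · β.right)
          simp [hψ₀, Whisker2.whiskL_nil, Whisker2.whiskR_whiskR, Whisker2.src]
        · simp [swapStep, hφ₁, ← hψ₁, φ₁.eq_of_steps_eq_nil hφ₁]
  | right φ g B S₂ hS₂ =>
    rename_i b c f f' h h' ψ ψ'
    obtain ⟨α, β, φ₀, φ₁, ψ₀, ψ₁, hφ, hφ₁, hψ₀, hψ, rfl⟩ := hS₂
    obtain ⟨Φ, hΦ⟩ := φ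
    obtain ⟨Φ, Φ', rfl, hφ₀, hα⟩ := List.map_eq_append_iff.mp hφ
    obtain ⟨α, rfl, rfl⟩ := List.map_eq_singleton_iff.mp hα
    obtain ⟨k, hΦ', rfl, hk⟩ := hΦ.exists_of_append
    obtain rfl : α.tgt = f' := hk
    -- The branching on the last whisker of `φ`, stripped of its left 1-cell `α.left`.
    have hbase : Closes
        (((Whisker3.ofGen B).whiskL (α.cod.comp (α.right.comp g))).precomp
          (((Cell2.ofGen α.gen).whiskR (α.right.comp g)).whiskR h))
        (swapStep Q.X ((Whisker2.ofGen α.gen).whiskR (α.right.comp g)) β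
          ((Composite.id _).copy rfl (by simp [Whisker2.src, Whisker2.whiskR, Whisker2.ofGen]))
          ((Composite.id _).copy (by simp [Whisker2.tgt, Whisker2.whiskR, Whisker2.ofGen]) rfl)
          ψ₀ ψ₁) := by
      refine ⟨_, _, _, _, ?_, ?_, .gen (Q.naturalityRight α.gen (α.right.comp g) B)⟩
      · rfl
      · exact Composite.head?_steps_comp (IsFirstSwap.head?_interchanger Q.X
          ⟨_, _, _, _, _, _, rfl, rfl, hψ₀, hψ, rfl⟩) _
    -- The context: `α.left` on the left, and the other whiskers of `φ` above.
    have := hbase.context (f := (f.comp g).comp h) (g := (α.tgt.comp g).comp h') α.left .nil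
      (((Cell2.whiskR (⟨Φ, hΦ'⟩ : Q.Cell2 f α.src) g).whiskR h).copy rfl
        (by simp [Whisker2.src]))
      ((Composite.id _).copy (by simp [Whisker2.tgt]) rfl)
    convert this using 1
    · refine Whisker3.mk_congr _ ?_ ?_ ?_ ?_
      · change Quiver.Path.comp (((α.left.comp α.cod).comp α.right).comp g) .nil =
          α.left.comp ((α.cod.comp (α.right.comp g)).comp .nil)
        simp
      · rfl
      · change ((Φ ++ [α]).map (Whisker2.whiskR · g)).map (Whisker2.whiskR · h) ++ [] =
          (Φ.map (Whisker2.whiskR · g)).map (Whisker2.whiskR · h) ++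
            [(((Whisker2.ofGen α.gen).whiskR (α.right.comp g)).whiskR h).whiskL α.left]
        simp [Whisker2.whiskR_whiskR, Whisker2.whiskL_whiskR_ofGen]
      · rfl
    · refine Whisker3.mk_congr_interchange Q.X _ _ ?_ ?_ ?_ ?_ ?_
      · simp [Whisker2.whiskR, Whisker2.ofGen]
      · rfl
      · rfl
      · change φ₀.steps.map (Whisker2.whiskR · h) ++
            ψ₀.steps.map (Whisker2.whiskL (α.whiskR g).src) =
          (Φ.map (Whisker2.whiskR · g)).map (Whisker2.whiskR · h) ++ ((ψ₀.steps.map (Whisker2.whiskL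
            ((Whisker2.ofGen α.gen).whiskR (α.right.comp g)).src)).map
              (Whisker2.whiskL α.left)).map (Whisker2.whiskR · .nil)
        simp [hψ₀, ← hφ₀]
      · change ψ₁.steps.map (Whisker2.whiskL (α.whiskR g).tgt) ++
            φ₁.steps.map (Whisker2.whiskR · h') =
          ((ψ₁.steps.map (Whisker2.whiskL
            ((Whisker2.ofGen α.gen).whiskR (α.right.comp g)).tgt) ++ []).map
              (Whisker2.whiskL α.left)).map (Whisker2.whiskR · .nil) ++ []
        simp [hφ₁, Whisker2.whiskL_whiskL, Whisker2.whiskR_nil, Whisker2.tgt_whiskR,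
          Whisker2.tgt_ofGen, show α.tgt = (α.left.comp α.cod).comp α.right from rfl]

theorem closes_of_isMinimal
    (hcrit : ∀ (x y : Q.Gen0) (f g : Q.Cell1 x y) (b : Q.LocalBranching f g),
      b.IsCritical Q.X → Q.IsConfluentLocal b)
    {x y : Q.Gen0} {f g : Q.Cell1 x y} (b : Q.LocalBranching f g) (hb : b.IsMinimal) :
    Closes b.fst b.snd := by
  by_cases hc : b.IsCritical Q.X
  · exact (hcrit _ _ _ _ b hc).closes
  · simp only [LocalBranching.IsCritical, hb, true_and, not_and_or, not_not] at hc
    obtain (h | h | h) | (h | h | h) := hc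
    · rw [show b.fst = b.snd from h]
      exact .refl _
    · exact closes_of_isIndependent h
    · exact closes_of_isNatural h
    · rw [show b.snd = b.fst from h]
      exact .refl _
    · exact (closes_of_isIndependent h).symm
    · exact (closes_of_isNatural h).symm

/-- By induction on the size, the confluence of the critical branchings gives that of all local
branchings. -/
theorem closes_of_critical
    (hcrit : ∀ (x y : Q.Gen0) (f g : Q.Cell1 x y) (b : Q.LocalBranching f g),
      b.IsCritical Q.X → Q.IsConfluentLocal b)
    {x y : Q.Gen0} {f g : Q.Cell1 x y} (b : Q.LocalBranching f g) : Closes b.fst b.snd := by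
  suffices H : ∀ (n : ℕ × ℕ) {x y : Q.Gen0} {f g : Q.Cell1 x y} (b : Q.LocalBranching f g),
      (b.fst.src.steps.length, f.length) = n → Closes b.fst b.snd from H _ b rfl
  intro n
  induction n using (WellFounded.prod_lex (wellFounded_lt (α := ℕ))
    (wellFounded_lt (α := ℕ))).induction with
  | _ n ih =>
    intro x y f g b hn
    by_cases hb : b.IsMinimal
    · exact closes_of_isMinimal hcrit b hb
    · simp only [LocalBranching.IsMinimal, not_forall] at hb
      obtain ⟨x', y', f', g', b', l, r, μ, ρ, h₁, h₂, hne⟩ := hb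
      rw [h₁, h₂]
      refine (ih _ ?_ b' rfl).context l r μ ρ
      rw [← hn, h₁]
      exact size_lt_of_context _ l r μ ρ hne

end GrayPresentation

/-! ### Newman's lemma and coherence -/

namespace Prepolygraph4

open Prepolygraph3

variable {Q : Prepolygraph4.{u, v, w, t, s}} {x y : Q.Gen0} {f g : Q.Cell1 x y}

/-- The rewriting relation between 2-cells, read backwards. -/
def RewritesFrom (Q : Prepolygraph4.{u, v, w, t, s}) {x y : Q.Gen0} (f g : Q.Cell1 x y)
    (ψ φ : Q.Cell2 f g) : Prop :=
  ∃ S : Q.Whisker3 f g, S.src = φ ∧ S.tgt = ψ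

theorem wellFounded_rewritesFrom (h : Q.IsTerminating) (f g : Q.Cell1 x y) :
    WellFounded (Q.RewritesFrom f g) := by
  rw [wellFounded_iff_isEmpty_descending_chain]
  refine ⟨fun ⟨φ, hφ⟩ => h ?_⟩
  choose S hs ht using hφ
  exact ⟨x, y, f, g, S, fun i => (ht i).trans (hs (i + 1)).symm⟩

/-- A 2-cell is a normal form when it is the source of no rewriting step. -/
def IsNormal (φ : Q.Cell2 f g) : Prop := ∀ S : Q.Whisker3 f g, S.src ≠ φ

theorem exists_normalForm (h : Q.IsTerminating) (φ : Q.Cell2 f g) :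
    ∃ ψ : Q.Cell2 f g, IsNormal ψ ∧ Nonempty (Q.Cell3 φ ψ) := by
  induction φ using (wellFounded_rewritesFrom h f g).induction with
  | _ φ ih =>
    by_cases hφ : IsNormal φ
    · exact ⟨φ, hφ, ⟨Composite.id φ⟩⟩
    · simp only [IsNormal, ne_eq, not_forall, not_not] at hφ
      obtain ⟨S, rfl⟩ := hφ
      obtain ⟨ψ, hψ, ⟨F⟩⟩ := ih S.tgt ⟨S, rfl, rfl⟩
      exact ⟨ψ, hψ, ⟨(Composite.single S).comp F⟩⟩

/-- Newman's lemma, keeping track of the congruence: if all local branchings close, then two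
rewriting paths from a 2-cell to normal forms have the same target and are congruent. -/
theorem congr_of_isNormal (h : Q.IsTerminating)
    (hclose : ∀ b : Q.LocalBranching f g, Closes b.fst b.snd) (φ : Q.Cell2 f g) :
    ∀ {ψ₁ ψ₂ : Q.Cell2 f g} (_ : IsNormal ψ₁) (_ : IsNormal ψ₂) (F₁ : Q.Cell3 φ ψ₁)
      (F₂ : Q.Cell3 φ ψ₂), ∃ e : ψ₁ = ψ₂, Q.Congr (F₁.copy rfl e) F₂ := by
  induction φ using (wellFounded_rewritesFrom h f g).induction with
  | _ φ ih =>
    rintro ψ₁ ψ₂ h₁ h₂ ⟨_ | ⟨S₁, L₁⟩, hL₁⟩ ⟨_ | ⟨S₂, L₂⟩, hL₂⟩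
    · obtain rfl : φ = ψ₁ := hL₁
      obtain rfl : φ = ψ₂ := hL₂
      exact ⟨rfl, .refl _⟩
    · obtain rfl : φ = ψ₁ := hL₁
      exact (h₁ S₂ hL₂.1).elim
    · obtain rfl : φ = ψ₂ := hL₂
      exact (h₂ S₁ hL₁.1).elim
    · obtain ⟨χ, ω, ⟨_ | ⟨T₁, M₁⟩, hM₁⟩, ⟨_ | ⟨T₂, M₂⟩, hM₂⟩, e₁, e₂, hG⟩ :=
        hclose ⟨S₁, S₂, hL₁.1.trans hL₂.1.symm⟩
      · simp at e₁
      · simp at e₁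
      · simp at e₂
      · obtain rfl : T₁ = S₁ := by simpa using e₁
        obtain rfl : T₂ = S₂ := by simpa using e₂
        obtain rfl : χ = φ := hM₁.1.symm.trans hL₁.1
        -- `K` normalizes the common target of the paths that close the branching of first steps;
        -- the induction hypothesis then applies after each of these steps.
        obtain ⟨ν, hν, ⟨K⟩⟩ := exists_normalForm h ω
        obtain ⟨rfl, k₁⟩ := ih T₁.tgt ⟨T₁, hL₁.1, rfl⟩ h₁ hν ⟨L₁, hL₁.2⟩
          (Composite.comp ⟨M₁, hM₁.2⟩ K)
        obtain ⟨rfl, k₂⟩ := ih T₂.tgt ⟨T₂, hL₂.1, rfl⟩ h₂ hν ⟨L₂, hL₂.2⟩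
          (Composite.comp ⟨M₂, hM₂.2⟩ K)
        refine ⟨rfl, ?_⟩
        have k₁' := Congr.comp (.refl ⟨[T₁], hL₁.1, rfl⟩) k₁
        have k₂' := Congr.comp (.refl ⟨[T₂], hL₂.1, rfl⟩) k₂
        exact k₁'.trans ((hG.comp (.refl K)).trans k₂'.symm)

/-- Replacing the target of a 3-cell by an equal one is composition with `eqToHom` in the presented
precategory. -/
theorem map_copy {φ ψ ψ' : Q.HomCat f g} (F : φ ⟶ ψ) (e : ψ = ψ') :
    (Quotient.functor (Q.homRel f g)).map (Y := ψ') (Composite.copy F rfl e) =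
      (Quotient.functor (Q.homRel f g)).map F ≫
        eqToHom (congrArg (Quotient.functor (Q.homRel f g)).obj e) := by
  subst e
  exact (Category.comp_id _).symm

/-- A terminating 4-prepolygraph whose local branchings all close is coherent: by
`congr_of_isNormal` the normalizations of the 2-cells commute with all 3-cells of the presented precategory. -/
theorem isCoherent_of_closes (h : Q.IsTerminating)
    (hclose : ∀ {x y : Q.Gen0} {f g : Q.Cell1 x y} (b : Q.LocalBranching f g),
      Closes b.fst b.snd) : Q.IsCoherent := by
  intro x y f g φ ψ F₁ F₂
  choose nf hnf hN using fun φ : Q.Cell2 f g => exists_normalForm h φ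
  refine FreeGroupoid.hom_ext_of_normalization (C := Q.PresentedHomCat f g) (fun φ => ⟨nf φ.as⟩)
    (fun φ => (Quotient.functor (Q.homRel f g)).map (hN φ.as).some) ?_ F₁ F₂
  rintro ⟨φ⟩ ⟨ψ⟩ F
  obtain ⟨F, rfl⟩ := (Quotient.functor (Q.homRel f g)).map_surjective F
  obtain ⟨e, he⟩ := congr_of_isNormal h hclose φ (hnf φ) (hnf ψ) (hN φ).some
    (Composite.comp F (hN ψ).some)
  exact ⟨congrArg _ e, (map_copy _ e).symm.trans
    ((CategoryTheory.Quotient.sound (Q.homRel f g) he).trans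
      ((Quotient.functor (Q.homRel f g)).map_comp _ _))⟩

end Prepolygraph4

theorem mainTheorem1 (Q : GrayPresentation.{u, v, w, t, s})
    (hterm : Q.IsTerminating)
    (hcrit : ∀ (x y : Q.Gen0) (f g : Q.Cell1 x y) (b : Q.LocalBranching f g),
      b.IsCritical Q.X → Q.IsConfluentLocal b) :
    Q.IsCoherent :=
  Prepolygraph4.isCoherent_of_closes hterm (GrayPresentation.closes_of_critical hcrit)
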